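/- Let $m,n,s$ be natural numbers and let $A\in\mathbb Z^{m\times n}$ have rank $m$. Let $\operatorname{IP}(\mathbf b)$, for $\mathbf b\in\mathbb Z^m$, denote an integer program $\max\{\mathbf c^{\intercal}\mathbf z : A\mathbf z=\mathbf b,\ \mathbf z\in\mathbb Z^n_{\ge 0}\}$; it is feasible if and only if $\mathbf b=A\mathbf z$ for some $\mathbf z\in\mathbb Z^n_{\ge0}$. Let $f:\mathbb Z^m\to\mathbb R_{\ge0}\cup\{\infty\}$ satisfy $f(\mathbf b)<\infty$ if and only if $\operatorname{IP}(\mathbf b)$ is feasible, and let $\alpha\in\mathbb R$. For $E\subseteq\mathbb Z^m$ define the lower asymptotic density $$\Pr(E):=\liminf_{t\to\infty}\frac{|\{\mathbf b\in E:\|\mathbf b\|_\infty\le t,\ f(\mathbf b)<\infty\}|}{|\{\mathbf b\in\mathbb Z^m:\|\mathbf b\|_\infty\le t,\ f(\mathbf b)<\infty\}|}\quad(t\in\mathbb Z_{\ge1}),\qquad \Pr(f\le\alpha):=\Pr(\{\mathbf b\in\mathbb Z^m: f(\mathbf b)\le\alpha\}).$$ For a matrix $M$ with $m$ rows, let $\operatorname{cone}(M)\subseteq\mathbb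 R^m$ be the set of nonnegative real linear combinations of its columns. Let $\gamma$ be the greatest common divisor of the numbers $|\det(D)|$ over all $m\times m$ submatrices $D$ of $A$. Let $A^1,\dots,A^s$ be a simplicial covering of $\operatorname{cone}(A)$, that is, each $A^i$ is an $m\times m$ submatrix of $A$ with $\det(A^i)\ne0$, and $\operatorname{cone}(A)=\bigcup_{i=1}^s\operatorname{cone}(A^i)$. Put $\Lambda:=A\cdot\mathbb Z^n$ and, for each $i$, let $\mathbf d^i\in\operatorname{cone}(A^i)\cap\mathbb Z^m$, $\Gamma^i:=A^i\cdot\mathbb Z^m$, and let $$\beta_i:=\bigl|\bigl\{\mathbf g\in\Lambda/\Gamma^i:\ f(\mathbf b)\le\alpha\ \text{ for all } \mathbf b\in\mathbf g\cap(\operatorname{cone}(A^i)+\mathbf d^i)\bigr\}\bigr|$$ be the number of cosets of $\Gamma^i$ in $\Lambda$ on which $f\le\alpha$ holds throughout the shifted cone $\operatorname{cone}(A^i)+\mathbf d^i$. Let $\det(\Gamma^i)$ be the determinant of the lattice $\Gamma^i$, i.e. $|\det(D)|$ for any $D\in\mathbb Z^{m\times m}$ with $\Gamma^i=D\cdot\mathbb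 Z^m$. Then $$\Pr(f\le\alpha)\ \ge\ \min_{i=1,\dots,s}\ \frac{\beta_i}{\gamma^{-1}\cdot\det(\Gamma^i)}.$$ -/

import Mathlib

open Filter Matrix

/-- The integer program `max {cᵀz : A z = b, z ∈ ℤⁿ, z ≥ 0}` is feasible.
Feasibility does not involve the objective vector `c`. -/
def IPFeasible {m n : ℕ} (A : Matrix (Fin m) (Fin n) ℤ) (b : Fin m → ℤ) : Prop :=
  ∃ z : Fin n → ℤ, 0 ≤ z ∧ A *ᵥ z = b

/-- An integer vector viewed as a real vector. -/
def realVec {m : ℕ} (b : Fin m → ℤ) : Fin m → ℝ := fun i => (b i : ℝ)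

/-- `cone(A)`: the convex cone (containing the origin) generated in `ℝᵐ` by the columns of `A`. -/
def matCone {m k : ℕ} (A : Matrix (Fin m) (Fin k) ℤ) : PointedCone ℝ (Fin m → ℝ) :=
  PointedCone.hull ℝ (Set.range fun j : Fin k => realVec (A.col j))

/-- The translate `cone(B) + d`. -/
def shiftedCone {m k : ℕ} (B : Matrix (Fin m) (Fin k) ℤ) (d : Fin m → ℤ) : Set (Fin m → ℝ) :=
  (fun x => x + realVec d) '' (matCone B : Set (Fin m → ℝ))

/-- The integer lattice `A · ℤᵏ ⊆ ℤᵐ` generated by the columns of `A`. -/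
def matLattice {m k : ℕ} (A : Matrix (Fin m) (Fin k) ℤ) : Submodule ℤ (Fin m → ℤ) :=
  LinearMap.range A.mulVecLin

open Classical in
/-- The determinant of a lattice `Γ ⊆ ℤᵐ`: the value `|det B|`, where `B` is any `m × m` integer
matrix with `Γ = B · ℤᵐ`. It does not depend on `B`, see `latticeDet_matLattice`. -/
noncomputable def latticeDet {m : ℕ} (Γ : Submodule ℤ (Fin m → ℤ)) : ℕ :=
  if h : ∃ B : Matrix (Fin m) (Fin m) ℤ, Γ = matLattice B then h.choose.det.natAbs else 0

theorem det_dvd_of_matLattice_le {m : ℕ} {B C : Matrix (Fin m) (Fin m) ℤ}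
    (h : matLattice B ≤ matLattice C) : C.det ∣ B.det := by
  have h1 : ∀ j, ∃ v : Fin m → ℤ, C *ᵥ v = B.col j := by
    intro j
    have : B.col j ∈ matLattice C := h ⟨Pi.single j 1, by simp⟩
    obtain ⟨v, hv⟩ := this
    exact ⟨v, by simpa using hv⟩
  choose v hv using h1
  have h2 : B = C * (Matrix.of v)ᵀ := by
    ext i j
    have := congrFun (hv j) i
    simpa [Matrix.mul_apply, Matrix.mulVec, dotProduct] using this.symm
  rw [h2, Matrix.det_mul]
  exact dvd_mul_right _ _

/-- The lattice determinant is well defined: every generating square matrix gives it. -/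
theorem latticeDet_matLattice {m : ℕ} (B : Matrix (Fin m) (Fin m) ℤ) :
    latticeDet (matLattice B) = B.det.natAbs := by
  have h : ∃ C : Matrix (Fin m) (Fin m) ℤ, matLattice B = matLattice C := ⟨B, rfl⟩
  rw [latticeDet, dif_pos h]
  exact Int.natAbs_eq_of_dvd_dvd (det_dvd_of_matLattice_le h.choose_spec.le)
    (det_dvd_of_matLattice_le h.choose_spec.ge)

/-- `B` is an `m × m` submatrix of `A`: it consists of `m` (differently indexed) columns of `A`,
in any order. -/
def IsColSubmatrix {m n : ℕ} (B : Matrix (Fin m) (Fin m) ℤ) (A : Matrix (Fin m) (Fin n) ℤ) :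
    Prop :=
  ∃ e : Fin m ↪ Fin n, B = A.submatrix id e

/-- `γ`: the greatest common divisor of `|det B|` over all `m × m` submatrices `B` of `A`. -/
noncomputable def minorGcd {m n : ℕ} (A : Matrix (Fin m) (Fin n) ℤ) : ℕ :=
  Finset.univ.gcd fun e : Fin m ↪ Fin n => (A.submatrix id e).det.natAbs

/-- `B 0, …, B (s - 1)` form a simplicial covering of `cone(A)`. -/
structure IsSimplicialCovering {m n s : ℕ} (A : Matrix (Fin m) (Fin n) ℤ)
    (B : Fin s → Matrix (Fin m) (Fin m) ℤ) : Prop where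
  submatrix : ∀ i, IsColSubmatrix (B i) A
  det_ne_zero : ∀ i, (B i).det ≠ 0
  cover : (matCone A : Set (Fin m → ℝ)) = ⋃ i, (matCone (B i) : Set (Fin m → ℝ))

/-- `Pr_t(E)`: the proportion, among the integer vectors `b` with `‖b‖_∞ ≤ t` and `f(b) < ∞`, of
those that lie in `E`. The norm of `Fin m → ℤ` is the maximum norm. -/
noncomputable def boxDensity {m : ℕ} (f : (Fin m → ℤ) → ENNReal) (t : ℕ)
    (E : Set (Fin m → ℤ)) : ℝ :=
  ({b : Fin m → ℤ | b ∈ E ∧ ‖b‖ ≤ t ∧ f b < ⊤}.ncard : ℝ) /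
    ({b : Fin m → ℤ | ‖b‖ ≤ t ∧ f b < ⊤}.ncard : ℝ)

/-- The lower asymptotic density `Pr(E) = liminf_{t → ∞} Pr_t(E)`. -/
noncomputable def lowerDensity {m : ℕ} (f : (Fin m → ℤ) → ENNReal) (E : Set (Fin m → ℤ)) : ℝ :=
  liminf (fun t : ℕ => boxDensity f t E) atTop

/-- The sublevel set `{b ∈ ℤᵐ : f(b) ≤ α}`; the comparison takes place in the extended reals, so
that `α` may be any real number. -/
def sublevel {m : ℕ} (f : (Fin m → ℤ) → ENNReal) (α : ℝ) : Set (Fin m → ℤ) :=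
  {b | (f b : EReal) ≤ (α : EReal)}

/-- `β`: the number of classes `g ∈ Λ/Γ`, where `Λ = A · ℤⁿ` and `Γ = B · ℤᵐ`, such that
`f(b) ≤ α` for all `b` in the class `g` that lie in `cone(B) + d`. For `B` a submatrix of `A` one
has `Γ ⊆ Λ`, so that every `b ∈ ℤᵐ` congruent to an element of `Λ` modulo `Γ` lies in `Λ`. -/
noncomputable def goodClassCount {m n : ℕ} (A : Matrix (Fin m) (Fin n) ℤ)
    (f : (Fin m → ℤ) → ENNReal) (α : ℝ) (B : Matrix (Fin m) (Fin m) ℤ) (d : Fin m → ℤ) : ℕ :=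
  {g : matLattice A ⧸ (matLattice B).submoduleOf (matLattice A) |
    ∀ b : matLattice A, Submodule.Quotient.mk b = g →
      realVec (b : Fin m → ℤ) ∈ shiftedCone B d → (b : Fin m → ℤ) ∈ sublevel f α}.ncard

/-!
The proof is an averaging argument over translates. Put `Λ = A · ℤⁿ`, `Γᵢ = B i · ℤᵐ`, and let `R`
be a system of representatives of the finite group `Λ / ⋂ᵢ Γᵢ`. For `b ∈ Λ` and each `i`, the
translates `b + r`, `r ∈ R`, meet all classes of `Λ / Γᵢ` equally often
(`card_translate_mem_mul_card`). Hence, if all of them lie in `cone(B i) + d i`, at least the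
proportion `βᵢ / [Λ : Γᵢ]` of them lies in the sublevel set of `f`. Counting the pairs `(b, r)` in
two ways (`mul_card_le_card_mul_card`) bounds the number of good points of a box from below by the
minimum of these proportions times the number of feasible points `b` for which some `i` satisfies
this condition with all translates in the box. No volumes are needed, and the cones may overlap.

The remaining feasible points of the box of radius `t` lie within bounded distance of a facet of
some `cone(B i)` or of the box, hence on boundedly many slices `v ⬝ᵥ b = c` with `v ≠ 0`; there are
`O(t ^ (m - 1))` of them (`exists_card_boundary_mul_le`), which is negligible against the number of
feasible points, of order `t ^ m` (`exists_card_box_le_mul_card_feasible`).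

Finally `[Λ : Γᵢ] ≤ γ⁻¹ · det Γᵢ` (`card_quotient_pos_and_le`): since
`det Γᵢ = [ℤᵐ : Λ] · [Λ : Γᵢ]`, it suffices that `γ` divides `[ℤᵐ : Λ]`, and this index is, up to
sign, the determinant of a matrix `A * U`, which expands into multiples of maximal minors of `A`.
-/

/-! ### Lattices, indices and the gcd of the maximal minors -/

/-- The part of the Cauchy–Binet formula that matters here: expanding the determinant
multilinearly in the columns of `A * U`, every term is a multiple of a maximal minor of `A`. -/
theorem minorGcd_dvd_det_mul {m n : ℕ} (A : Matrix (Fin m) (Fin n) ℤ)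
    (U : Matrix (Fin n) (Fin m) ℤ) : (minorGcd A : ℤ) ∣ (A * U).det := by
  have h : (A * U).det = Matrix.detRowAlternating (fun j => ∑ k, U k j • A.col k) := by
    rw [← Matrix.det_transpose]
    change Matrix.det _ = Matrix.det _
    congr 1
    ext j i
    simp [Matrix.mul_apply, mul_comm, Finset.sum_apply]
  rw [h]
  change _ ∣ Matrix.detRowAlternating.toMultilinearMap _
  rw [MultilinearMap.map_sum]
  refine Finset.dvd_sum fun r _ => ?_
  rw [MultilinearMap.map_smul_univ]
  refine Dvd.dvd.mul_left ?_ _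
  have h1 : Matrix.detRowAlternating.toMultilinearMap (fun i => A.col (r i)) =
      (A.submatrix id r).det := by
    rw [← Matrix.det_transpose]; rfl
  rw [h1]
  by_cases hr : Function.Injective r
  · rw [← Int.dvd_natAbs, Int.natCast_dvd_natCast]
    exact Finset.gcd_dvd (f := fun e : Fin m ↪ Fin n => (A.submatrix id e).det.natAbs)
      (Finset.mem_univ (⟨r, hr⟩ : Fin m ↪ Fin n))
  · simp only [Function.Injective, not_forall] at hr
    obtain ⟨i, j, hij, hne⟩ := hr
    rw [Matrix.det_zero_of_column_eq hne fun k => by simp [hij]]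
    exact dvd_zero _

theorem index_matLattice {m : ℕ} {B : Matrix (Fin m) (Fin m) ℤ} (hB : B.det ≠ 0) :
    (matLattice B).toAddSubgroup.index = B.det.natAbs := by
  let e : (Fin m → ℤ) ≃ₗ[ℤ] matLattice B :=
    LinearEquiv.ofInjective B.mulVecLin (mulVec_injective_of_det_ne_zero hB)
  have h := Submodule.natAbs_det_equiv (matLattice B) e
  have h2 : (matLattice B).subtype ∘ₗ AddMonoidHom.toIntLinearMap (e : (Fin m → ℤ) →+ matLattice B)
      = Matrix.toLin' B := by
    ext; rfl
  rw [h2, LinearMap.det_toLin'] at h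
  exact h.symm

theorem matLattice_le_of_isColSubmatrix {m n : ℕ} {A : Matrix (Fin m) (Fin n) ℤ}
    {B : Matrix (Fin m) (Fin m) ℤ} (hBA : IsColSubmatrix B A) : matLattice B ≤ matLattice A := by
  obtain ⟨e, rfl⟩ := hBA
  rintro _ ⟨z, rfl⟩
  have h : A.submatrix id e = A * (1 : Matrix (Fin n) (Fin n) ℤ).submatrix id e := by
    ext i j
    simp [Matrix.mul_apply, Matrix.one_apply]
  refine ⟨(1 : Matrix (Fin n) (Fin n) ℤ).submatrix id e *ᵥ z, ?_⟩
  simp only [Matrix.mulVecLin_apply]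
  rw [h, Matrix.mulVec_mulVec]

/-- A lattice `A · ℤⁿ` of finite index is spanned by the columns of a square matrix `A * U`, whose
determinant is, up to sign, the index of the lattice, and a multiple of the gcd of the minors. -/
theorem minorGcd_dvd_index {m n : ℕ} (A : Matrix (Fin m) (Fin n) ℤ)
    (hA : (matLattice A).toAddSubgroup.index ≠ 0) :
    minorGcd A ∣ (matLattice A).toAddSubgroup.index := by
  obtain ⟨e⟩ := Int.submodule_toAddSubgroup_index_ne_zero_iff.1 hA
  have h := Submodule.natAbs_det_equiv (matLattice A) e.symm
  set φ := (matLattice A).subtype ∘ₗ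
    AddMonoidHom.toIntLinearMap (e.symm : (Fin m → ℤ) →+ matLattice A) with hφ
  have h1 : ∀ j : Fin m, ∃ u : Fin n → ℤ, A *ᵥ u = φ (Pi.single j 1) := fun j =>
    (e.symm (Pi.single j 1)).2
  choose u hu using h1
  have h2 : LinearMap.toMatrix' φ = A * (Matrix.of u)ᵀ := by
    ext i j
    rw [LinearMap.toMatrix'_apply, ← hu j]
    simp [Matrix.mul_apply, Matrix.mulVec, dotProduct]
  rw [← LinearMap.det_toMatrix', h2] at h
  change _ = (matLattice A).toAddSubgroup.index at h
  rw [← h, ← Int.natCast_dvd]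
  exact minorGcd_dvd_det_mul A _

theorem minorGcd_pos {m n : ℕ} {A : Matrix (Fin m) (Fin n) ℤ} {B : Matrix (Fin m) (Fin m) ℤ}
    (hBA : IsColSubmatrix B A) (hB : B.det ≠ 0) : 0 < minorGcd A := by
  obtain ⟨e, rfl⟩ := hBA
  refine Nat.pos_of_ne_zero fun h => hB ?_
  have := Finset.gcd_eq_zero_iff.1 h e (Finset.mem_univ e)
  simpa using this

theorem card_quotient_pos_and_le {m n : ℕ} {A : Matrix (Fin m) (Fin n) ℤ}
    {B : Matrix (Fin m) (Fin m) ℤ} (hBA : IsColSubmatrix B A) (hB : B.det ≠ 0) :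
    0 < Nat.card (matLattice A ⧸ (matLattice B).submoduleOf (matLattice A)) ∧
      minorGcd A * Nat.card (matLattice A ⧸ (matLattice B).submoduleOf (matLattice A)) ≤
        B.det.natAbs := by
  have h : Nat.card (matLattice A ⧸ (matLattice B).submoduleOf (matLattice A)) *
      (matLattice A).toAddSubgroup.index = B.det.natAbs := by
    rw [← index_matLattice hB]
    exact AddSubgroup.relIndex_mul_index
      (H := (matLattice B).toAddSubgroup) (K := (matLattice A).toAddSubgroup)
      (matLattice_le_of_isColSubmatrix hBA)
  have h0 : B.det.natAbs ≠ 0 := Int.natAbs_ne_zero.2 hB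
  rw [← h] at h0
  have hi := right_ne_zero_of_mul h0
  refine ⟨Nat.pos_of_ne_zero (left_ne_zero_of_mul h0), ?_⟩
  rw [← h, mul_comm]
  exact Nat.mul_le_mul_left _ (Nat.le_of_dvd (Nat.pos_of_ne_zero hi) (minorGcd_dvd_index A hi))

/-! ### Uniform distribution of a translated system of representatives -/

/-- Let `P ⊆ Q` be submodules with `M ⧸ P` finite. A translate of a system of representatives of
`M ⧸ P` meets all classes of `M ⧸ Q` equally often. -/
theorem card_translate_mem_mul_card {M : Type*} [AddCommGroup M] {P Q : Submodule ℤ M}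
    (hPQ : P ≤ Q) [Finite (M ⧸ P)] (S : Set (M ⧸ Q)) (x : M) :
    {g : M ⧸ P | (Submodule.Quotient.mk (x + Quotient.out g) : M ⧸ Q) ∈ S}.ncard *
      Nat.card (M ⧸ Q) = S.ncard * Nat.card (M ⧸ P) := by
  classical
  set φ : (M ⧸ P) →ₗ[ℤ] (M ⧸ Q) := Submodule.factor hPQ
  have hφ : Function.Surjective φ := Submodule.factor_surjective hPQ
  have : Finite (M ⧸ Q) := Finite.of_surjective φ hφ
  have := Fintype.ofFinite (M ⧸ P)
  have := Fintype.ofFinite (M ⧸ Q)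
  -- all fibres of `φ` have the same size
  set K := (Finset.univ.filter fun g : M ⧸ P => φ g = 0).card
  have hK : ∀ y, (Finset.univ.filter fun g : M ⧸ P => φ g = y).card = K := fun y =>
    AddMonoidHom.card_fiber_eq_of_mem_range φ (hφ y) (hφ 0)
  have hcount : ∀ T : Finset (M ⧸ Q),
      (Finset.univ.filter fun g : M ⧸ P => φ g ∈ T).card = T.card * K := by
    intro T
    rw [Finset.card_eq_sum_card_fiberwise (f := φ) (t := T) (fun g hg => by simpa using hg)]
    rw [Finset.sum_congr rfl (g := fun _ => K), Finset.sum_const, smul_eq_mul]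
    intro y hy
    rw [← hK y, Finset.filter_filter]
    congr 1
    ext g
    simp only [Finset.mem_filter, Finset.mem_univ, true_and]
    exact ⟨fun h => h.2, fun h => ⟨h ▸ hy, h⟩⟩
  have hall : Nat.card (M ⧸ P) = Nat.card (M ⧸ Q) * K := by
    have := hcount Finset.univ
    simpa [Nat.card_eq_fintype_card] using this
  have hset : {g : M ⧸ P | (Submodule.Quotient.mk (x + Quotient.out g) : M ⧸ Q) ∈ S}.ncard =
      S.ncard * K := by
    have h1 : {g : M ⧸ P | (Submodule.Quotient.mk (x + Quotient.out g) : M ⧸ Q) ∈ S} =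
        (Equiv.addLeft (Submodule.Quotient.mk x : M ⧸ P)) ⁻¹'
          ((Finset.univ.filter fun g : M ⧸ P => φ g ∈ S.toFinset : Finset (M ⧸ P)) :
            Set (M ⧸ P)) := by
      ext g
      have h2 : φ (Submodule.Quotient.mk x + g) =
          Submodule.Quotient.mk (x + Quotient.out g) := by
        conv_lhs => rw [← Quotient.out_eq g]
        rfl
      simp only [Set.mem_ofPred_eq, Set.mem_preimage, Equiv.coe_addLeft, Finset.mem_coe,
        Finset.mem_filter, Finset.mem_univ, true_and, Set.mem_toFinset]
      rw [h2]
    rw [h1, ← Equiv.image_symm_eq_preimage, Set.ncard_image_of_injective _ (Equiv.injective _),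
      Set.ncard_coe_finset, hcount, Set.ncard_eq_toFinset_card']
  rw [hset, hall]
  ring

theorem finite_quotient_iInf {M ι : Type*} [AddCommGroup M] [Finite ι] (P : ι → Submodule ℤ M)
    [∀ i, Finite (M ⧸ P i)] : Finite (M ⧸ ⨅ i, P i) := by
  have h : LinearMap.ker (LinearMap.pi fun i => (P i).mkQ) = ⨅ i, P i := by
    rw [LinearMap.ker_pi]; simp
  rw [← h]
  exact Finite.of_injective _ (LinearEquiv.injective
    (LinearMap.quotKerEquivRange (LinearMap.pi fun i => (P i).mkQ)))

/-- Averaging: if from every point of `I` at least `c` of the finitely many translations `r g` lead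
into `J`, then `c * #I` is at most the number of translations times `#J`. -/
theorem mul_card_le_card_mul_card {V G : Type*} [AddGroup V] [Fintype G] [DecidableEq V]
    (r : G → V) (I J : Finset V) (c : ℝ)
    (h : ∀ x ∈ I, c ≤ ({g | x + r g ∈ J} : Set G).ncard) :
    c * I.card ≤ Fintype.card G * J.card := by
  classical
  -- count the pairs `(x, g)` with `x + r g ∈ J` in two ways
  have h1 : c * I.card ≤ ∑ x ∈ I, ((Finset.univ.filter fun g => x + r g ∈ J).card : ℝ) := by
    rw [mul_comm, ← nsmul_eq_mul]
    refine Finset.card_nsmul_le_sum _ _ _ fun x hx => ?_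
    refine (h x hx).trans_eq ?_
    rw [← Set.ncard_coe_finset]
    simp
  refine h1.trans ?_
  have h2 : ∑ x ∈ I, (Finset.univ.filter fun g => x + r g ∈ J).card =
      ∑ g : G, (I.filter fun x => x + r g ∈ J).card :=
    Finset.sum_card_bipartiteAbove_eq_sum_card_bipartiteBelow fun x g => x + r g ∈ J
  have h3 : ∑ g : G, (I.filter fun x => x + r g ∈ J).card ≤ Fintype.card G * J.card := by
    rw [← smul_eq_mul, ← Finset.card_univ]
    refine Finset.sum_le_card_nsmul _ _ _ fun g _ => ?_
    exact Finset.card_le_card_of_injOn (fun x => x + r g)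
      (fun x hx => (Finset.mem_filter.1 hx).2) (fun x _ y _ hxy => add_right_cancel hxy)
  exact_mod_cast h2.trans_le h3

/-! ### Simplicial cones -/

theorem mem_matCone_iff_exists {m k : ℕ} (A : Matrix (Fin m) (Fin k) ℤ) (x : Fin m → ℝ) :
    x ∈ matCone A ↔ ∃ z : Fin k → ℝ, 0 ≤ z ∧ A.map (Int.cast : ℤ → ℝ) *ᵥ z = x := by
  have hsum : ∀ z : Fin k → ℝ,
      ∑ j, z j • realVec (A.col j) = A.map (Int.cast : ℤ → ℝ) *ᵥ z := by
    intro z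
    ext i
    simp [Matrix.mulVec, dotProduct, realVec, mul_comm]
  rw [matCone, PointedCone.hull, Submodule.mem_span_range_iff_exists_fun]
  constructor
  · rintro ⟨c, rfl⟩
    exact ⟨fun j => (c j : ℝ), fun j => (c j).2, (hsum _).symm⟩
  · rintro ⟨z, hz, rfl⟩
    exact ⟨fun j => ⟨z j, hz j⟩, hsum z⟩

theorem map_mulVec_realVec {m k : ℕ} (A : Matrix (Fin m) (Fin k) ℤ) (b : Fin k → ℤ) :
    A.map (Int.cast : ℤ → ℝ) *ᵥ realVec b = realVec (A *ᵥ b) := by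
  ext i
  simp [Matrix.mulVec, dotProduct, realVec]

/-- The integer matrix `sign(det B) · adj B = |det B| · B⁻¹`, whose rows are inner normals of the
facets of the simplicial cone `cone(B)`. -/
def facetNormals {m : ℕ} (B : Matrix (Fin m) (Fin m) ℤ) : Matrix (Fin m) (Fin m) ℤ :=
  B.det.sign • B.adjugate

theorem facetNormals_mul {m : ℕ} (B : Matrix (Fin m) (Fin m) ℤ) :
    facetNormals B * B = |B.det| • (1 : Matrix (Fin m) (Fin m) ℤ) := by
  rw [facetNormals, Matrix.smul_mul, Matrix.adjugate_mul, smul_smul, Int.sign_mul_self_eq_abs]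

theorem mul_facetNormals {m : ℕ} (B : Matrix (Fin m) (Fin m) ℤ) :
    B * facetNormals B = |B.det| • (1 : Matrix (Fin m) (Fin m) ℤ) := by
  rw [facetNormals, Matrix.mul_smul, Matrix.mul_adjugate, smul_smul, Int.sign_mul_self_eq_abs]

theorem facetNormals_row_ne_zero {m : ℕ} {B : Matrix (Fin m) (Fin m) ℤ} (hB : B.det ≠ 0)
    (j : Fin m) : facetNormals B j ≠ 0 := by
  intro h
  have h1 := congrFun (congrFun (facetNormals_mul B) j) j
  rw [Matrix.mul_apply] at h1
  simp [h] at h1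
  exact hB (abs_eq_zero.1 h1.symm)

theorem realVec_mem_matCone_iff {m : ℕ} {B : Matrix (Fin m) (Fin m) ℤ} (hB : B.det ≠ 0)
    (b : Fin m → ℤ) : realVec b ∈ matCone B ↔ 0 ≤ facetNormals B *ᵥ b := by
  have hpos : (0 : ℝ) < ((|B.det| : ℤ) : ℝ) := by exact_mod_cast abs_pos.2 hB
  have hcast : ∀ M N : Matrix (Fin m) (Fin m) ℤ, M * N = |B.det| • 1 →
      M.map (Int.cast : ℤ → ℝ) * N.map (Int.cast : ℤ → ℝ) = ((|B.det| : ℤ) : ℝ) • 1 := by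
    intro M N h
    have h1 := congrArg (fun X : Matrix (Fin m) (Fin m) ℤ => X.map (Int.cast : ℤ → ℝ)) h
    change (M * N).map (Int.castRingHom ℝ) = _ at h1
    rw [Matrix.map_mul] at h1
    refine h1.trans ?_
    ext i j
    simp only [Matrix.map_apply, Matrix.smul_apply, Matrix.one_apply]
    split_ifs <;> simp
  rw [mem_matCone_iff_exists]
  constructor
  · rintro ⟨z, hz, hzb⟩ j
    have h1 := map_mulVec_realVec (facetNormals B) b
    rw [← hzb, Matrix.mulVec_mulVec, hcast _ _ (facetNormals_mul B), Matrix.smul_mulVec,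
      Matrix.one_mulVec] at h1
    have h2 : (0 : ℝ) ≤ ((facetNormals B *ᵥ b) j : ℤ) := by
      have h3 := congrFun h1 j
      change _ = ((facetNormals B *ᵥ b) j : ℝ) at h3
      rw [← h3]
      exact mul_nonneg hpos.le (hz j)
    exact_mod_cast h2
  · intro h
    refine ⟨((|B.det| : ℤ) : ℝ)⁻¹ • realVec (facetNormals B *ᵥ b), fun j => ?_, ?_⟩
    · refine mul_nonneg (inv_nonneg.2 hpos.le) ?_
      have := h j
      change (0 : ℝ) ≤ (((facetNormals B *ᵥ b) j : ℤ) : ℝ)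
      exact_mod_cast this
    · rw [← map_mulVec_realVec, Matrix.mulVec_smul, Matrix.mulVec_mulVec,
        hcast _ _ (mul_facetNormals B), Matrix.smul_mulVec, Matrix.one_mulVec, smul_smul,
        inv_mul_cancel₀ hpos.ne', one_smul]

theorem realVec_mem_shiftedCone_iff {m : ℕ} {B : Matrix (Fin m) (Fin m) ℤ} (hB : B.det ≠ 0)
    (b d : Fin m → ℤ) : realVec b ∈ shiftedCone B d ↔ 0 ≤ facetNormals B *ᵥ (b - d) := by
  have hsub : realVec (b - d) = realVec b - realVec d := by ext i; simp [realVec]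
  rw [← realVec_mem_matCone_iff hB, hsub, shiftedCone]
  constructor
  · rintro ⟨x, hx, hxb⟩
    rw [← hxb]
    simpa using hx
  · intro h
    exact ⟨_, h, sub_add_cancel _ _⟩

theorem IPFeasible.realVec_mem_matCone {m n : ℕ} {A : Matrix (Fin m) (Fin n) ℤ} {b : Fin m → ℤ}
    (h : IPFeasible A b) : realVec b ∈ matCone A := by
  obtain ⟨z, hz, rfl⟩ := h
  exact (mem_matCone_iff_exists A _).2
    ⟨realVec z, fun j => Int.cast_nonneg (hz j), map_mulVec_realVec A z⟩

theorem IPFeasible.mem_matLattice {m n : ℕ} {A : Matrix (Fin m) (Fin n) ℤ} {b : Fin m → ℤ}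
    (h : IPFeasible A b) : b ∈ matLattice A := by
  obtain ⟨z, -, rfl⟩ := h
  exact ⟨z, rfl⟩

theorem IPFeasible.of_isColSubmatrix {m n : ℕ} {A : Matrix (Fin m) (Fin n) ℤ}
    {B : Matrix (Fin m) (Fin m) ℤ} (hBA : IsColSubmatrix B A) {z : Fin m → ℤ} (hz : 0 ≤ z) :
    IPFeasible A (B *ᵥ z) := by
  obtain ⟨e, rfl⟩ := hBA
  have h : A.submatrix id e = A * (1 : Matrix (Fin n) (Fin n) ℤ).submatrix id e := by
    ext i j
    simp [Matrix.mul_apply, Matrix.one_apply]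
  refine ⟨(1 : Matrix (Fin n) (Fin n) ℤ).submatrix id e *ᵥ z, fun i => ?_, ?_⟩
  · change 0 ≤ ∑ j, _ * z j
    refine Finset.sum_nonneg fun j _ => mul_nonneg ?_ (hz j)
    simp only [Matrix.submatrix_apply, id, Matrix.one_apply]
    split_ifs <;> simp
  · rw [h, Matrix.mulVec_mulVec]

/-! ### Counting lattice points in boxes -/

/-- The integer vectors `b` with `‖b‖_∞ ≤ t`. -/
noncomputable def intBox (m t : ℕ) : Finset (Fin m → ℤ) :=
  Fintype.piFinset fun _ => Finset.Icc (-(t : ℤ)) t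

theorem mem_intBox {m t : ℕ} {b : Fin m → ℤ} : b ∈ intBox m t ↔ ∀ k, |b k| ≤ t := by
  simp [intBox, abs_le]

theorem norm_le_iff_mem_intBox {m t : ℕ} {b : Fin m → ℤ} : ‖b‖ ≤ t ↔ b ∈ intBox m t := by
  rw [mem_intBox, pi_norm_le_iff_of_nonneg (Nat.cast_nonneg t)]
  refine forall_congr' fun k => ?_
  rw [Int.norm_eq_abs]
  exact_mod_cast Iff.rfl

theorem card_intBox (m t : ℕ) : (intBox m t).card = (2 * t + 1) ^ m := by
  rw [intBox, Fintype.card_piFinset_const, Int.card_Icc]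
  congr 1
  omega

/-- A coordinate `k` with `v k ≠ 0` is determined on the slice by the others, so letting it vary
freely embeds `2 t + 1` copies of the slice into the box. -/
theorem card_slice_mul_le {m : ℕ} {v : Fin m → ℤ} (hv : v ≠ 0) (t : ℕ) (c : ℤ) :
    (2 * t + 1) * ((intBox m t).filter fun b => v ⬝ᵥ b = c).card ≤ (2 * t + 1) ^ m := by
  obtain ⟨k, hk⟩ := Function.ne_iff.1 hv
  have h1 : (Finset.Icc (-(t : ℤ)) t).card = 2 * t + 1 := by rw [Int.card_Icc]; omega
  rw [← card_intBox m t]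
  conv_lhs => rw [← h1]
  rw [← Finset.card_product]
  refine Finset.card_le_card_of_injOn (fun p => Function.update p.2 k p.1) ?_ ?_
  · rintro ⟨u, b⟩ hp
    simp only [Finset.coe_product, Set.mem_prod, Finset.mem_coe, Finset.mem_Icc,
      Finset.mem_filter] at hp
    refine mem_intBox.2 fun j => ?_
    by_cases hj : j = k
    · subst hj
      simpa [abs_le] using hp.1
    · simpa [hj] using mem_intBox.1 hp.2.1 j
  · rintro ⟨u, b⟩ hp ⟨u', b'⟩ hp' heq
    simp only [Finset.coe_product, Set.mem_prod, Finset.mem_coe, Finset.mem_filter] at hp hp'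
    have hne : ∀ j, j ≠ k → b j = b' j := fun j hj => by
      simpa [hj] using congrFun heq j
    have hu : u = u' := by simpa using congrFun heq k
    have hdot : v ⬝ᵥ (b - b') = 0 := by rw [dotProduct_sub, hp.2.2, hp'.2.2, sub_self]
    have hkk : b k = b' k := by
      rw [dotProduct, Finset.sum_eq_single k (fun j _ hj => by simp [hne j hj]) (by simp)] at hdot
      exact sub_eq_zero.1 ((mul_eq_zero.1 hdot).resolve_left hk)
    refine Prod.ext hu (funext fun j => ?_)
    by_cases hj : j = k
    · exact hj ▸ hkk
    · exact hne j hj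

theorem card_union_slices_mul_le {m : ℕ} {ι : Type*} [Fintype ι] (v : ι → Fin m → ℤ)
    (hv : ∀ i, v i ≠ 0) (t : ℕ) (c : ι → ℤ) (S : Finset (Fin m → ℤ))
    (hS : ∀ b ∈ S, b ∈ intBox m t ∧ ∃ i, v i ⬝ᵥ b = c i) :
    (2 * t + 1) * S.card ≤ Fintype.card ι * (2 * t + 1) ^ m := by
  classical
  have hsub : S ⊆ Finset.univ.biUnion fun i => (intBox m t).filter fun b => v i ⬝ᵥ b = c i := by
    intro b hb
    obtain ⟨h1, i, h2⟩ := hS b hb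
    exact Finset.mem_biUnion.2 ⟨i, Finset.mem_univ i, Finset.mem_filter.2 ⟨h1, h2⟩⟩
  calc (2 * t + 1) * S.card
      ≤ (2 * t + 1) * ∑ i, ((intBox m t).filter fun b => v i ⬝ᵥ b = c i).card := by
        gcongr
        exact (Finset.card_le_card hsub).trans Finset.card_biUnion_le
    _ ≤ Fintype.card ι * (2 * t + 1) ^ m := by
        rw [Finset.mul_sum, ← smul_eq_mul (a := Fintype.card ι), ← Finset.card_univ]
        exact Finset.sum_le_card_nsmul _ _ _ fun i _ => card_slice_mul_le (hv i) t (c i)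

open Classical in
/-- The feasible right-hand sides in the box of radius `t` make up at least a fixed positive
fraction of that box. -/
theorem exists_card_box_le_mul_card_feasible {m n : ℕ} {A : Matrix (Fin m) (Fin n) ℤ}
    {B : Matrix (Fin m) (Fin m) ℤ} (hBA : IsColSubmatrix B A) (hB : B.det ≠ 0) :
    ∃ C : ℕ, ∀ t : ℕ,
      (2 * t + 1) ^ m ≤ C * ((intBox m t).filter fun b => IPFeasible A b).card := by
  obtain ⟨K, hK⟩ := Finite.exists_le fun i : Fin m => ∑ j, (B i j).natAbs
  refine ⟨(2 * (K + 1)) ^ m, fun t => ?_⟩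
  obtain ⟨q, hq⟩ : ∃ q, q = t / (K + 1) := ⟨_, rfl⟩
  have hqt : K * q ≤ t :=
    (Nat.mul_le_mul_right q K.le_succ).trans (hq ▸ Nat.mul_div_le t (K + 1))
  have htq : t < (K + 1) * (q + 1) := hq ▸ Nat.lt_mul_div_succ t K.succ_pos
  -- `B z` is feasible and lies in the box for every `z` with `0 ≤ z ≤ q`
  have h1 : (q + 1) ^ m ≤ ((intBox m t).filter fun b => IPFeasible A b).card := by
    have h2 : (Fintype.piFinset fun _ : Fin m => Finset.Icc (0 : ℤ) (q : ℤ)).card =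
        (q + 1) ^ m := by
      rw [Fintype.card_piFinset_const, Int.card_Icc]
      congr 1
    rw [← h2]
    refine Finset.card_le_card_of_injOn (fun z => B *ᵥ z) (fun z hz => ?_)
      (Matrix.mulVec_injective_of_det_ne_zero hB).injOn
    have hz' : ∀ j, 0 ≤ z j ∧ z j ≤ (q : ℤ) := fun j =>
      Finset.mem_Icc.1 (Fintype.mem_piFinset.1 hz j)
    refine Finset.mem_filter.2 ⟨mem_intBox.2 fun i => ?_,
      IPFeasible.of_isColSubmatrix hBA fun j => (hz' j).1⟩
    change |∑ j, B i j * z j| ≤ (t : ℤ)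
    calc |∑ j, B i j * z j| ≤ ∑ j, |B i j * z j| :=
          Finset.abs_sum_le_sum_abs (fun j => B i j * z j) Finset.univ
      _ ≤ ∑ j, ((B i j).natAbs : ℤ) * (q : ℤ) := by
          refine Finset.sum_le_sum fun j _ => ?_
          rw [abs_mul, Int.abs_eq_natAbs, abs_of_nonneg (hz' j).1]
          exact mul_le_mul_of_nonneg_left (hz' j).2 (Int.natCast_nonneg _)
      _ = ((∑ j, (B i j).natAbs : ℕ) : ℤ) * (q : ℤ) := by
          rw [Nat.cast_sum, Finset.sum_mul]
      _ ≤ t := by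
          have h3 : (∑ j, (B i j).natAbs) * q ≤ t := (Nat.mul_le_mul_right q (hK i)).trans hqt
          exact_mod_cast h3
  calc (2 * t + 1) ^ m ≤ (2 * (K + 1) * (q + 1)) ^ m := by
        refine Nat.pow_le_pow_left ?_ m
        rw [mul_assoc]
        omega
    _ = (2 * (K + 1)) ^ m * (q + 1) ^ m := mul_pow _ _ _
    _ ≤ _ := Nat.mul_le_mul_left _ h1

/-! ### Points near the boundary of the cones or of the box -/

open Classical in
/-- Let `r` be a finite family of translations. A lattice point of `cone(A)` in the box of radius
`t` for which no `cone(B i) + d i`, intersected with the box, contains all its translates is within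
bounded distance of a facet of some `cone(B i)` or of the box. So it lies on one of boundedly many
slices. -/
theorem exists_card_boundary_mul_le {m n s : ℕ} {A : Matrix (Fin m) (Fin n) ℤ}
    {B : Fin s → Matrix (Fin m) (Fin m) ℤ} (hB : IsSimplicialCovering A B)
    (d : Fin s → Fin m → ℤ) {G : Type*} [Finite G] (r : G → Fin m → ℤ) :
    ∃ C : ℕ, ∀ t : ℕ, (2 * t + 1) * ((intBox m t).filter fun b => realVec b ∈ matCone A ∧
      ¬ ∃ i, ∀ g, realVec (b + r g) ∈ shiftedCone (B i) (d i) ∧ b + r g ∈ intBox m t).card ≤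
        C * (2 * t + 1) ^ m := by
  obtain ⟨K₁, hK₁⟩ := Finite.exists_le fun p : Fin s × Fin m × G =>
    ((facetNormals (B p.1) *ᵥ (r p.2.2 - d p.1)) p.2.1).natAbs
  obtain ⟨K₂, hK₂⟩ := Finite.exists_le fun p : G × Fin m => (r p.1 p.2).natAbs
  -- slices `ℓ b = c` with `ℓ` a facet normal and `0 ≤ c ≤ K₁`, or
  -- `± b k = t - c` with `0 ≤ c ≤ K₂`
  let ι := (Fin s × Fin m × Fin (K₁ + 1)) ⊕ (ℤˣ × Fin m × Fin (K₂ + 1))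
  let v : ι → Fin m → ℤ := Sum.elim (fun p => facetNormals (B p.1) p.2.1)
    fun p => Pi.single p.2.1 (p.1 : ℤ)
  refine ⟨Fintype.card ι, fun t => card_union_slices_mul_le v ?_ t
    (Sum.elim (fun p => (p.2.2 : ℕ)) fun p => (t : ℤ) - (p.2.2 : ℕ)) _ ?_⟩
  · rintro (p | p)
    · exact facetNormals_row_ne_zero (hB.det_ne_zero p.1) p.2.1
    · simp [v]
  intro b hb
  obtain ⟨hbt, hbA, hbad⟩ := Finset.mem_filter.1 hb
  refine ⟨hbt, ?_⟩
  have hcov : realVec b ∈ (matCone A : Set (Fin m → ℝ)) := hbA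
  rw [hB.cover] at hcov
  obtain ⟨i, hi⟩ := Set.mem_iUnion.1 hcov
  have hi' := (realVec_mem_matCone_iff (hB.det_ne_zero i) b).1 hi
  push Not at hbad
  obtain ⟨g, hg⟩ := hbad i
  by_cases hcone : realVec (b + r g) ∈ shiftedCone (B i) (d i)
  · have hbox := hg hcone
    rw [mem_intBox] at hbox hbt
    push Not at hbox
    obtain ⟨k, hk⟩ := hbox
    have hr : (r g k).natAbs ≤ K₂ := hK₂ (g, k)
    have hbk := hbt k
    rw [Pi.add_apply] at hk
    rw [abs_le] at hbk
    rcases lt_abs.1 hk with h | h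
    · refine ⟨Sum.inr (1, k, ⟨(t - b k).toNat, by omega⟩), ?_⟩
      simp only [v, Sum.elim_inr, Units.val_one, single_dotProduct]
      omega
    · refine ⟨Sum.inr (-1, k, ⟨(t + b k).toNat, by omega⟩), ?_⟩
      simp only [v, Sum.elim_inr, Units.val_neg, Units.val_one, single_dotProduct]
      omega
  · rw [realVec_mem_shiftedCone_iff (hB.det_ne_zero i), Pi.le_def] at hcone
    push Not at hcone
    obtain ⟨j, hj⟩ := hcone
    have hK : ((facetNormals (B i) *ᵥ (r g - d i)) j).natAbs ≤ K₁ := hK₁ (i, j, g)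
    have h0 : (0 : ℤ) ≤ (facetNormals (B i) *ᵥ b) j := hi' j
    rw [add_sub_assoc, Matrix.mulVec_add, Pi.add_apply] at hj
    rw [Pi.zero_apply] at hj
    refine ⟨Sum.inl (i, j, ⟨((facetNormals (B i) *ᵥ b) j).toNat, by omega⟩), ?_⟩
    change (facetNormals (B i) *ᵥ b) j = (((facetNormals (B i) *ᵥ b) j).toNat : ℤ)
    omega

/-! ### The density bound -/

theorem sublevel_lt_top {m : ℕ} {f : (Fin m → ℤ) → ENNReal} {α : ℝ} {b : Fin m → ℤ}
    (h : b ∈ sublevel f α) : f b < ⊤ := by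
  refine lt_top_iff_ne_top.2 fun htop => ?_
  have h1 : (f b : EReal) ≤ (α : EReal) := h
  rw [htop, EReal.coe_ennreal_top, top_le_iff] at h1
  exact EReal.coe_ne_top α h1

open Classical in
theorem boxDensity_eq {m n : ℕ} {A : Matrix (Fin m) (Fin n) ℤ} {f : (Fin m → ℤ) → ENNReal}
    (hf : ∀ b, f b < ⊤ ↔ IPFeasible A b) (α : ℝ) (t : ℕ) :
    boxDensity f t (sublevel f α) = (((intBox m t).filter fun b => b ∈ sublevel f α).card : ℝ) /
      ((intBox m t).filter fun b => IPFeasible A b).card := by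
  rw [boxDensity, ← Set.ncard_coe_finset, ← Set.ncard_coe_finset]
  congr 3
  · ext b
    simp only [Set.mem_ofPred_eq, Finset.coe_filter, norm_le_iff_mem_intBox]
    exact ⟨fun h => ⟨h.2.1, h.1⟩, fun h => ⟨h.2, h.1, sublevel_lt_top h.2⟩⟩
  · ext b
    simp only [Set.mem_ofPred_eq, Finset.coe_filter, norm_le_iff_mem_intBox, hf]

theorem boxDensity_le_one {m n : ℕ} {A : Matrix (Fin m) (Fin n) ℤ} {f : (Fin m → ℤ) → ENNReal}
    (hf : ∀ b, f b < ⊤ ↔ IPFeasible A b) (α : ℝ) (t : ℕ) :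
    boxDensity f t (sublevel f α) ≤ 1 := by
  classical
  rw [boxDensity_eq hf]
  refine div_le_one_of_le₀ ?_ (Nat.cast_nonneg _)
  refine Nat.cast_le.2 (Finset.card_le_card fun b hb => ?_)
  rw [Finset.mem_filter] at hb ⊢
  exact ⟨hb.1, (hf b).1 (sublevel_lt_top hb.2)⟩

open Classical in
/-- Averaging over a system of representatives of `Λ / ⋂ᵢ Γᵢ`: the translates of a point of `Λ`
meet all classes of `Λ / Γᵢ` equally often. -/
theorem mul_card_interior_le {m n s : ℕ} {A : Matrix (Fin m) (Fin n) ℤ}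
    (f : (Fin m → ℤ) → ENNReal) (α : ℝ) (B : Fin s → Matrix (Fin m) (Fin m) ℤ)
    (d : Fin s → Fin m → ℤ) {μ : ℝ} (P : Fin s → Submodule ℤ (matLattice A))
    (hPB : ∀ i, P i = (matLattice (B i)).submoduleOf (matLattice A))
    (hP : ∀ i, 0 < Nat.card (matLattice A ⧸ P i)) [Finite (matLattice A ⧸ ⨅ i, P i)]
    (hμ : ∀ i, μ * Nat.card (matLattice A ⧸ P i) ≤ goodClassCount A f α (B i) (d i))
    (t : ℕ) (I : Finset (Fin m → ℤ))
    (hI : ∀ x ∈ I, x ∈ matLattice A ∧ ∃ i, ∀ g : matLattice A ⧸ ⨅ i, P i,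
      realVec (x + ((Quotient.out g : matLattice A) : Fin m → ℤ)) ∈ shiftedCone (B i) (d i) ∧
        x + ((Quotient.out g : matLattice A) : Fin m → ℤ) ∈ intBox m t) :
    μ * I.card ≤ ((intBox m t).filter fun b => b ∈ sublevel f α).card := by
  have := Fintype.ofFinite (matLattice A ⧸ ⨅ i, P i)
  have hcardG : (0 : ℝ) < Fintype.card (matLattice A ⧸ ⨅ i, P i) := by
    exact_mod_cast Fintype.card_pos
  have h := mul_card_le_card_mul_card
    (fun g : matLattice A ⧸ ⨅ i, P i => ((Quotient.out g : matLattice A) : Fin m → ℤ)) I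
    ((intBox m t).filter fun b => b ∈ sublevel f α)
    (μ * Fintype.card (matLattice A ⧸ ⨅ i, P i)) fun x hx => ?_
  · rw [mul_right_comm, mul_comm] at h
    exact le_of_mul_le_mul_left h hcardG
  obtain ⟨hxΛ, i, hi⟩ := hI x hx
  obtain ⟨S, hS⟩ : ∃ S : Set (matLattice A ⧸ P i), S = {g | ∀ b : matLattice A,
    Submodule.Quotient.mk b = g → realVec (b : Fin m → ℤ) ∈ shiftedCone (B i) (d i) →
      (b : Fin m → ℤ) ∈ sublevel f α} := ⟨_, rfl⟩
  have hScard : S.ncard = goodClassCount A f α (B i) (d i) := by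
    rw [hS, hPB i]; rfl
  obtain ⟨N, hN⟩ : ∃ N : Set (matLattice A ⧸ ⨅ i, P i), N = {g | (Submodule.Quotient.mk
    ((⟨x, hxΛ⟩ : matLattice A) + Quotient.out g) : matLattice A ⧸ P i) ∈ S} := ⟨_, rfl⟩
  have hcount : N.ncard * Nat.card (matLattice A ⧸ P i) =
      S.ncard * Nat.card (matLattice A ⧸ ⨅ i, P i) := by
    rw [hN]
    exact card_translate_mem_mul_card (iInf_le P i) S ⟨x, hxΛ⟩
  have hsub : N ⊆ {g | x + ((Quotient.out g : matLattice A) : Fin m → ℤ) ∈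
      (intBox m t).filter fun b => b ∈ sublevel f α} := by
    intro g hg
    rw [hN, hS] at hg
    exact Finset.mem_filter.2 ⟨(hi g).2, hg _ rfl (hi g).1⟩
  refine le_trans ?_ (Nat.cast_le.2 (Set.ncard_le_ncard hsub (Set.toFinite _)))
  rw [hScard, Nat.card_eq_fintype_card (α := matLattice A ⧸ ⨅ i, P i)] at hcount
  have hcount' : (N.ncard : ℝ) * Nat.card (matLattice A ⧸ P i) =
      goodClassCount A f α (B i) (d i) * Fintype.card (matLattice A ⧸ ⨅ i, P i) := by
    exact_mod_cast hcount
  refine le_of_mul_le_mul_right ?_ (Nat.cast_pos.2 (hP i))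
  rw [hcount', mul_right_comm]
  exact mul_le_mul_of_nonneg_right (hμ i) hcardG.le

/-- Here `T` counts all points of a box of side `N`, `I` the interior ones, `D` the exceptional
ones and `J` the good ones. -/
theorem sub_div_le_div_of_card_bounds {μ : ℝ} (hμ : 0 ≤ μ) {N m T I D J C₁ C₂ : ℕ} (hN : 0 < N)
    (hIJ : μ * I ≤ J) (hT : T ≤ I + D) (hD : N * D ≤ C₁ * N ^ m) (hNT : N ^ m ≤ C₂ * T) :
    μ - μ * (C₁ * C₂) / N ≤ J / T := by
  have hmul : N * T ≤ N * I + C₁ * C₂ * T := by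
    calc N * T ≤ N * I + N * D := by rw [← mul_add]; exact Nat.mul_le_mul_left _ hT
      _ ≤ N * I + C₁ * (C₂ * T) :=
          Nat.add_le_add_left (hD.trans (Nat.mul_le_mul_left _ hNT)) _
      _ = N * I + C₁ * C₂ * T := by rw [mul_assoc]
  have hmul' : (N : ℝ) * T ≤ N * I + C₁ * C₂ * T := by exact_mod_cast hmul
  have hTpos : (0 : ℝ) < T := by
    have h1 : 0 < C₂ * T := lt_of_lt_of_le (Nat.pow_pos hN) hNT
    exact_mod_cast Nat.pos_of_mul_pos_left h1
  have hN' : (0 : ℝ) < N := Nat.cast_pos.2 hN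
  rw [le_div_iff₀ hTpos]
  refine le_trans ?_ hIJ
  have h2 : (T : ℝ) - C₁ * C₂ / N * T ≤ I := by
    rw [div_mul_eq_mul_div, sub_le_iff_le_add, ← sub_le_iff_le_add', le_div_iff₀ hN']
    linarith
  calc (μ - μ * (C₁ * C₂) / N) * T = μ * (T - C₁ * C₂ / N * T) := by ring
    _ ≤ μ * I := mul_le_mul_of_nonneg_left h2 hμ

/-- If a lower bound `μ` for the proportion of good classes holds for each simplicial cone, then in
every box it holds for the sublevel set up to an error inversely proportional to the side length.
The index `i₀` only expresses that the covering is not empty. -/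
theorem exists_le_boxDensity {m n s : ℕ} {A : Matrix (Fin m) (Fin n) ℤ}
    {f : (Fin m → ℤ) → ENNReal} (hf : ∀ b, f b < ⊤ ↔ IPFeasible A b) (α : ℝ)
    {B : Fin s → Matrix (Fin m) (Fin m) ℤ} (hB : IsSimplicialCovering A B) (i₀ : Fin s)
    (d : Fin s → Fin m → ℤ) {μ : ℝ} (hμ0 : 0 ≤ μ)
    (hμ : ∀ i, μ * Nat.card (matLattice A ⧸ (matLattice (B i)).submoduleOf (matLattice A)) ≤
      goodClassCount A f α (B i) (d i)) :
    ∃ C : ℝ, ∀ t : ℕ, μ - C / ((2 * t + 1 : ℕ) : ℝ) ≤ boxDensity f t (sublevel f α) := by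
  classical
  obtain ⟨P, hPB⟩ : ∃ P : Fin s → Submodule ℤ (matLattice A),
    ∀ i, P i = (matLattice (B i)).submoduleOf (matLattice A) := ⟨_, fun _ => rfl⟩
  have hP : ∀ i, 0 < Nat.card (matLattice A ⧸ P i) := fun i =>
    hPB i ▸ (card_quotient_pos_and_le (hB.submatrix i) (hB.det_ne_zero i)).1
  have hPfin : ∀ i, Finite (matLattice A ⧸ P i) := fun i => Nat.finite_of_card_ne_zero (hP i).ne'
  have := finite_quotient_iInf P
  obtain ⟨C₁, hC₁⟩ := exists_card_boundary_mul_le hB d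
    fun g : matLattice A ⧸ ⨅ i, P i => ((Quotient.out g : matLattice A) : Fin m → ℤ)
  obtain ⟨C₂, hC₂⟩ :=
    exists_card_box_le_mul_card_feasible (hB.submatrix i₀) (hB.det_ne_zero i₀)
  refine ⟨μ * (C₁ * C₂), fun t => ?_⟩
  rw [boxDensity_eq hf]
  refine sub_div_le_div_of_card_bounds hμ0 (Nat.succ_pos _)
    (mul_card_interior_le f α B d P hPB hP (fun i => by rw [hPB i]; exact hμ i) t
      (((intBox m t).filter fun b => IPFeasible A b).filter fun b => ∃ i,
        ∀ g : matLattice A ⧸ ⨅ i, P i,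
          realVec (b + ((Quotient.out g : matLattice A) : Fin m → ℤ)) ∈ shiftedCone (B i) (d i) ∧
            b + ((Quotient.out g : matLattice A) : Fin m → ℤ) ∈ intBox m t)
      fun x hx => ?_) ?_ (hC₁ t) (hC₂ t)
  · obtain ⟨hxT, hi⟩ := Finset.mem_filter.1 hx
    exact ⟨(Finset.mem_filter.1 hxT).2.mem_matLattice, hi⟩
  · refine (Finset.card_filter_add_card_filter_not _).symm.trans_le
      (Nat.add_le_add_left (Finset.card_le_card fun b hb => ?_) _)
    obtain ⟨hbT, hb⟩ := Finset.mem_filter.1 hb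
    obtain ⟨hbt, hbA⟩ := Finset.mem_filter.1 hbT
    exact Finset.mem_filter.2 ⟨hbt, hbA.realVec_mem_matCone, hb⟩

theorem theorem2p3 {m n s : ℕ} (A : Matrix (Fin m) (Fin n) ℤ)
    (hA : (A.map (Int.cast : ℤ → ℝ)).rank = m)
    (f : (Fin m → ℤ) → ENNReal) (hf : ∀ b, f b < ⊤ ↔ IPFeasible A b) (α : ℝ)
    (B : Fin s → Matrix (Fin m) (Fin m) ℤ) (hB : IsSimplicialCovering A B)
    (d : Fin s → Fin m → ℤ) (hd : ∀ i, realVec (d i) ∈ matCone (B i)) :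
    (⨅ i : Fin s, (goodClassCount A f α (B i) (d i) : ℝ) /
        ((minorGcd A : ℝ)⁻¹ * (latticeDet (matLattice (B i)) : ℝ))) ≤
      lowerDensity f (sublevel f α) := by
  -- the origin lies in `cone(A)`, so the covering is not empty
  have h0 : (0 : Fin m → ℝ) ∈ (matCone A : Set (Fin m → ℝ)) := (matCone A).zero_mem
  rw [hB.cover] at h0
  obtain ⟨i₀, -⟩ := Set.mem_iUnion.1 h0
  set μ := ⨅ i : Fin s, (goodClassCount A f α (B i) (d i) : ℝ) /
    ((minorGcd A : ℝ)⁻¹ * (latticeDet (matLattice (B i)) : ℝ))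
  have hμ0 : 0 ≤ μ := Real.iInf_nonneg fun i => by positivity
  have hμ : ∀ i, μ * Nat.card (matLattice A ⧸ (matLattice (B i)).submoduleOf (matLattice A)) ≤
      goodClassCount A f α (B i) (d i) := by
    intro i
    have hγ : (0 : ℝ) < minorGcd A := by
      exact_mod_cast minorGcd_pos (hB.submatrix i) (hB.det_ne_zero i)
    have hdet : (0 : ℝ) < (B i).det.natAbs := by
      exact_mod_cast Int.natAbs_pos.2 (hB.det_ne_zero i)
    have hle : μ ≤ _ := ciInf_le (Set.finite_range _).bddBelow i
    rw [latticeDet_matLattice, le_div_iff₀ (by positivity)] at hle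
    refine (mul_le_mul_of_nonneg_left ?_ hμ0).trans hle
    rw [le_inv_mul_iff₀ hγ]
    exact_mod_cast (card_quotient_pos_and_le (hB.submatrix i) (hB.det_ne_zero i)).2
  obtain ⟨C, hC⟩ := exists_le_boxDensity hf α hB i₀ d hμ0 hμ
  have hlim : Tendsto (fun t : ℕ => μ - C / ((2 * t + 1 : ℕ) : ℝ)) atTop (nhds μ) := by
    have h1 : Tendsto (fun t : ℕ => ((2 * t + 1 : ℕ) : ℝ)) atTop atTop :=
      tendsto_natCast_atTop_atTop.comp
        (tendsto_atTop_mono (fun t => show t ≤ 2 * t + 1 by omega) tendsto_id)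
    simpa only [sub_zero] using tendsto_const_nhds.sub (h1.const_div_atTop C)
  rw [lowerDensity, ← hlim.liminf_eq]
  exact liminf_le_liminf (Eventually.of_forall hC) hlim.isBoundedUnder_ge
    (isBoundedUnder_of ⟨1, boxDensity_le_one hf α⟩ :
      IsBoundedUnder (· ≤ ·) _ _).isCoboundedUnder_ge
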